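/- Let $G=(V,E)$ be a finite simple planar $3$-connected graph (more than three vertices, and connected after the deletion of any two or fewer vertices), embedded in the sphere, let $F$ be the set of faces of the embedding, and let $G^*$ be the dual graph, with vertex set $F$, two faces being adjacent when they share an edge. Suppose that $G$ is strongly involutive self-dual, that is, there is a graph isomorphism $\tau : G\to G^*$ such that, writing $u\in\tau(v)$ when the vertex $u$ lies on the boundary of the face $\tau(v)$, 1. $v\notin\tau(v)$ for every $v\in V$; 2. $u\in\tau(v)\iff v\in\tau(u)$ for all $u,v\in V$. Then for every such $\tau$ there is a metric mapping of $G$, not necessarily injective: a map $\eta: V\to\mathbb R^3$ such that the set $\eta(V)$ has diameter $1$ and $|\eta(u)-\eta(v)|=1$ whenever $u\in\tau(v)$. -/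

import Mathlib

/-- `G` is `k`-connected: it has more than `k` vertices, and deleting any set of fewer than `k`
vertices leaves a connected graph. -/
def SimpleGraph.IsKConnected {V : Type*} (G : SimpleGraph V) (k : ℕ) : Prop :=
  k < Nat.card V ∧
    ∀ S : Finset V, S.card < k → (G.induce {v : V | v ∉ S}).Connected

/-- A rotation system on a graph `G`, i.e. a combinatorial map with underlying graph `G`:
a permutation `rot` of the darts (oriented edges) of `G` whose cycles are exactly the sets of darts
leaving a common vertex. `rot d` is the dart following `d` in the cyclic order around the initial
vertex of `d`. -/
structure RotationSystem {V : Type*} (G : SimpleGraph V) where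
  /-- The permutation turning each dart to the next one around its initial vertex. -/
  rot : Equiv.Perm G.Dart
  /-- Two darts are in the same cycle exactly if they leave the same vertex. -/
  sameCycle_iff : ∀ d e : G.Dart, rot.SameCycle d e ↔ d.fst = e.fst

namespace RotationSystem

variable {V : Type*} {G : SimpleGraph V}

/-- The face permutation: a dart `a → b` is followed, along the boundary of the face at its side,
by the dart `b → c` that comes after `b → a` in the rotation at `b`. -/
def facePerm (M : RotationSystem G) : Equiv.Perm G.Dart :=
  (Function.Involutive.toPerm SimpleGraph.Dart.symm SimpleGraph.Dart.symm_involutive).trans M.rot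

/-- The faces of the map: the cycles of the face permutation. -/
def Face (M : RotationSystem G) : Type _ :=
  Quotient (Equiv.Perm.SameCycle.setoid M.facePerm)

/-- The face that has the dart `d` on its boundary walk. -/
def faceOf (M : RotationSystem G) (d : G.Dart) : M.Face :=
  Quotient.mk (Equiv.Perm.SameCycle.setoid M.facePerm) d

/-- The set of vertices on the boundary of a face. -/
def verts (M : RotationSystem G) (f : M.Face) : Set V :=
  {v : V | ∃ d : G.Dart, M.faceOf d = f ∧ d.fst = v}

/-- The dual graph: its vertices are the faces, and two distinct faces are adjacent if some edge
has one of them on each side. -/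
def dualGraph (M : RotationSystem G) : SimpleGraph M.Face where
  Adj f g := f ≠ g ∧ ∃ d : G.Dart, M.faceOf d = f ∧ M.faceOf d.symm = g
  symm := ⟨by
    rintro f g ⟨hne, d, hf, hg⟩
    exact ⟨hne.symm, d.symm, hg, by rw [SimpleGraph.Dart.symm_symm]; exact hf⟩⟩
  loopless := ⟨fun f h => h.1 rfl⟩

/-- The map is an embedding in the sphere: the graph is connected and the Euler characteristic
`|V| - |E| + |F|` is `2`. (The graphs of interest have an edge, so every face has a dart on its
boundary.) -/
def IsSpherical (M : RotationSystem G) : Prop :=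
  G.Connected ∧ Nat.card V + Nat.card M.Face = Nat.card G.edgeSet + 2

/-- A strongly involutive self-duality: an isomorphism `τ` from the graph to its dual such that no
vertex lies on its own face, and `u ∈ τ v ↔ v ∈ τ u`. -/
structure IsStronglyInvolutive (M : RotationSystem G) (τ : G ≃g M.dualGraph) : Prop where
  notMem_self : ∀ v : V, v ∉ M.verts (τ v)
  mem_comm : ∀ u v : V, u ∈ M.verts (τ v) ↔ v ∈ M.verts (τ u)

/-- A metric mapping: the image has diameter `1`, and each vertex has distance `1` to every vertex
of its dual face. It need not be injective. -/
structure IsMetricMapping (M : RotationSystem G) (τ : G ≃g M.dualGraph)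
    (η : V → EuclideanSpace ℝ (Fin 3)) : Prop where
  diam_eq : Metric.diam (Set.range η) = 1
  dist_eq : ∀ u v : V, u ∈ M.verts (τ v) → dist (η u) (η v) = 1

end RotationSystem

/-! Join `u` and `v` when `u ∈ τ(v)`; strong involutivity makes this a simple graph. A proper
4-coloring, followed by the bijection from colors to the vertices of a regular tetrahedron of side
1, is a metric mapping.

The coloring exists because the graph is 3-degenerate. For a vertex set `W`, its edges inside `W`,
counted twice, are the incidences between `W` and the faces `τ(W)`. These form a simple bipartite
planar graph on `2|W|` nodes, so there are fewer than `4|W|` of them (`card_incidences_lt`) and some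
vertex of `W` has degree at most 3.

The planar bound is the usual one: Euler's inequality, and at least four edges around each face.
Euler's inequality for subgraphs of the vertex-face graph (`card_add_two_le`) is obtained by
homology over `ℚ`: on the sphere every cycle is a boundary. -/

/-- A graph is 4-colorable if every nonempty finite set of vertices contains a vertex with at most
three neighbours in the set. -/
theorem SimpleGraph.colorable_four_of_degenerate {V : Type*} [Finite V] (D : SimpleGraph V)
    (h : ∀ W : Finset V, W.Nonempty → ∃ v ∈ W, {u | u ∈ W ∧ D.Adj u v}.ncard < 4) :
    D.Colorable 4 := by
  classical
  have key : ∀ (n : ℕ) (W : Finset V), W.card = n →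
      ∃ c : V → Fin 4, ∀ u ∈ W, ∀ v ∈ W, D.Adj u v → c u ≠ c v := by
    intro n
    induction n with
    | zero =>
      intro W hW
      rw [Finset.card_eq_zero] at hW
      exact ⟨fun _ => 0, by simp [hW]⟩
    | succ n ih =>
      intro W hW
      obtain ⟨v, hv, hdeg⟩ := h W (Finset.card_pos.mp (by omega))
      obtain ⟨c, hc⟩ := ih (W.erase v) (by rw [Finset.card_erase_of_mem hv]; omega)
      obtain ⟨a, ha⟩ : ∃ a : Fin 4, a ∉ c '' {u | u ∈ W ∧ D.Adj u v} := by
        by_contra! hall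
        have h1 : c '' {u | u ∈ W ∧ D.Adj u v} = Set.univ := Set.eq_univ_of_forall hall
        have h2 := Set.ncard_image_le (f := c) (Set.toFinite {u | u ∈ W ∧ D.Adj u v})
        rw [h1, Set.ncard_univ, Nat.card_fin] at h2
        omega
      have ha' : ∀ u ∈ W, D.Adj u v → c u ≠ a := fun u hu huv hcu => ha ⟨u, ⟨hu, huv⟩, hcu⟩
      refine ⟨Function.update c v a, fun u hu w hw huw => ?_⟩
      by_cases huv : u = v
      · subst huv
        rw [Function.update_self, Function.update_of_ne huw.ne']
        exact (ha' w hw huw.symm).symm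
      · by_cases hwv : w = v
        · subst hwv
          rw [Function.update_self, Function.update_of_ne huv]
          exact ha' u hu huw
        · rw [Function.update_of_ne huv, Function.update_of_ne hwv]
          exact hc u (Finset.mem_erase.mpr ⟨huv, hu⟩) w (Finset.mem_erase.mpr ⟨hwv, hw⟩) huw
  have := Fintype.ofFinite V
  obtain ⟨c, hc⟩ := key _ Finset.univ rfl
  exact ⟨SimpleGraph.Coloring.mk c fun {u v} huv =>
    hc u (Finset.mem_univ u) v (Finset.mem_univ v) huv⟩

/-- Four points of Euclidean space at mutual distance one. -/
theorem exists_regular_tetrahedron :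
    ∃ p : Fin 4 → EuclideanSpace ℝ (Fin 3), ∀ i j, i ≠ j → dist (p i) (p j) = 1 := by
  have h2 : (√2 : ℝ) ^ 2 = 2 := Real.sq_sqrt (by norm_num)
  -- Alternate vertices of a cube of side `√2 / 2`, whose face diagonals have length 1.
  refine ⟨![!₂[√2 / 4, √2 / 4, √2 / 4], !₂[√2 / 4, -(√2 / 4), -(√2 / 4)],
    !₂[-(√2 / 4), √2 / 4, -(√2 / 4)], !₂[-(√2 / 4), -(√2 / 4), √2 / 4]], fun i j hij => ?_⟩
  rw [EuclideanSpace.dist_eq, Real.sqrt_eq_one]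
  fin_cases i <;> fin_cases j <;>
    first
    | exact absurd rfl hij
    | (simp [Fin.sum_univ_three, Real.dist_eq, sq_abs]
       nlinarith [h2])

/-- The dimension of the space of vectors orthogonal to a given subspace. -/
theorem finrank_comap_dualAnnihilator {K ι : Type*} [Field K] [Fintype ι] [DecidableEq ι]
    (W : Submodule K (ι → K)) :
    Module.finrank K W + Module.finrank K
      (W.dualAnnihilator.comap (dotProductEquiv K ι).toLinearMap) = Fintype.card ι := by
  have h := Subspace.finrank_add_finrank_dualAnnihilator_eq W
  rw [Module.finrank_fintype_fun_eq_card] at h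
  rw [← h, Submodule.comap_equiv_eq_map_symm, LinearEquiv.finrank_map_eq]


instance SimpleGraph.Dart.finite {V : Type*} [Finite V] (G : SimpleGraph V) : Finite G.Dart :=
  Finite.of_injective (fun d : G.Dart => d.toProd) SimpleGraph.Dart.toProd_injective

/-- If a sum vanishes, then every nonzero term is accompanied by another one. -/
theorem Finset.exists_ne_of_sum_eq_zero_of_ne_zero {ι M : Type*} [AddCommMonoid M]
    {s : Finset ι} {f : ι → M}
    (h : ∑ i ∈ s, f i = 0) {a : ι} (ha : a ∈ s) (hfa : f a ≠ 0) :
    ∃ b ∈ s, b ≠ a ∧ f b ≠ 0 := by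
  by_contra! hall
  exact hfa (by rw [← h, Finset.sum_eq_single_of_mem a ha hall])

/-! ### Darts and potentials on a connected map -/

namespace RotationSystem

variable {V : Type*} {G : SimpleGraph V} (M : RotationSystem G)

instance [Finite V] : Finite M.Face := Quotient.finite _

theorem fst_rot (d : G.Dart) : (M.rot d).fst = d.fst :=
  ((M.sameCycle_iff d (M.rot d)).mp (Equiv.Perm.sameCycle_apply_right.mpr (.refl _ _))).symm

theorem facePerm_apply (d : G.Dart) : M.facePerm d = M.rot d.symm := rfl

theorem faceOf_facePerm (d : G.Dart) : M.faceOf (M.facePerm d) = M.faceOf d :=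
  Quotient.sound (Equiv.Perm.sameCycle_apply_left.mpr (.refl _ _))

theorem rot_symm_eq_symm_facePerm_symm (d : G.Dart) :
    M.rot.symm d = (M.facePerm.symm d).symm := by
  rw [Equiv.symm_apply_eq, ← M.facePerm_apply, Equiv.apply_symm_apply]

variable {M}

/-- A function on the darts of a connected map that is invariant under reversal and rotation is
constant. -/
theorem eq_of_invariant (hG : G.Preconnected) {α : Type*} {x : G.Dart → α}
    (hsymm : ∀ d, x d.symm = x d) (hrot : ∀ d, x (M.rot d) = x d) (d e : G.Dart) : x d = x e := by
  have hpow : ∀ (i : ℤ) (d : G.Dart), x ((M.rot ^ i) d) = x d := by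
    intro i
    induction i using Int.induction_on with
    | zero => intro d; simp
    | succ n ih => intro d; rw [zpow_add_one, Equiv.Perm.mul_apply, ih, hrot]
    | pred n ih =>
      intro d
      rw [zpow_sub_one, Equiv.Perm.mul_apply, ih, ← hrot]
      exact congrArg x (M.rot.apply_symm_apply d)
  have hfst : ∀ d e : G.Dart, d.fst = e.fst → x d = x e := by
    intro d e hde
    obtain ⟨i, hi⟩ := (M.sameCycle_iff d e).mpr hde
    rw [← hi, hpow]
  have hwalk : ∀ (u v : V), G.Walk u v → ∀ d e : G.Dart, d.fst = u → e.fst = v → x d = x e := by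
    intro u v p
    induction p with
    | nil => intro d e hd he; exact hfst d e (hd.trans he.symm)
    | cons h p ih =>
      intro d e hd he
      rw [hfst d ⟨(_, _), h⟩ hd, ← hsymm]
      exact ih _ _ rfl he
  obtain ⟨p⟩ := hG d.fst e.fst
  exact hwalk _ _ p d e rfl rfl

/-- A vertex potential and a face potential that agree at all corners of a connected map are equal
constants. -/
theorem exists_eq_const_of_corner_eq (hG : G.Preconnected) [Nonempty V] {α : Type*} {y : V → α}
    {w : M.Face → α} (h : ∀ d, y d.fst = w (M.faceOf d)) :
    ∃ c, (∀ v, y v = c) ∧ ∀ f, w f = c := by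
  have hadj : ∀ d : G.Dart, y d.fst = y d.snd := by
    intro d
    -- The next dart of the same face starts at `d.snd`.
    rw [h, ← M.faceOf_facePerm, ← h, M.facePerm_apply, M.fst_rot]
    rfl
  have hwalk : ∀ (u v : V), G.Walk u v → y u = y v := by
    intro u v p
    induction p with
    | nil => rfl
    | cons h p ih => exact (hadj ⟨(_, _), h⟩).trans ih
  obtain ⟨v₀⟩ := ‹Nonempty V›
  have hy : ∀ v, y v = y v₀ := fun v => by
    obtain ⟨p⟩ := hG v v₀
    exact hwalk _ _ p
  refine ⟨y v₀, hy, fun f => ?_⟩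
  obtain ⟨d, rfl⟩ := Quotient.exists_rep f
  exact (h d).symm.trans (hy _)

/-! ### Homology of the vertex-face (corner) graph -/

variable (M)

/-- The coboundary of the corner graph, whose vertices are the vertices and faces of the map and
whose edges are the darts. -/
def cornerCoboundary : ((V → ℚ) × (M.Face → ℚ)) →ₗ[ℚ] (G.Dart → ℚ) where
  toFun y d := y.1 d.fst - y.2 (M.faceOf d)
  map_add' y y' := by ext d; simp only [Prod.fst_add, Prod.snd_add, Pi.add_apply]; ring
  map_smul' c y := by
    ext d; simp only [Prod.smul_fst, Prod.smul_snd, Pi.smul_apply, smul_eq_mul, RingHom.id_apply]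
    ring

/-- The boundary map of the corner graph: every edge of the map is surrounded by four corners. -/
def cornerBoundary : (G.edgeSet → ℚ) →ₗ[ℚ] (G.Dart → ℚ) where
  toFun x d := x ⟨d.edge, d.edge_mem⟩ - x ⟨(M.rot.symm d).edge, (M.rot.symm d).edge_mem⟩
  map_add' y y' := by ext d; simp only [Pi.add_apply]; ring
  map_smul' c y := by
    ext d; simp only [Pi.smul_apply, smul_eq_mul, RingHom.id_apply]
    ring

theorem finrank_ker_cornerCoboundary_le (hG : G.Connected) :
    Module.finrank ℚ (LinearMap.ker M.cornerCoboundary) ≤ 1 := by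
  have := hG.nonempty
  refine (Submodule.finrank_mono (t := Submodule.span ℚ {((1, 1) : (V → ℚ) × (M.Face → ℚ))})
    fun y hy => ?_).trans (by
      simpa using finrank_span_le_card (R := ℚ) {((1, 1) : (V → ℚ) × (M.Face → ℚ))})
  obtain ⟨c, h1, h2⟩ := exists_eq_const_of_corner_eq (M := M) hG.preconnected (y := y.1) (w := y.2)
    fun d => sub_eq_zero.mp (congrFun (LinearMap.mem_ker.mp hy) d)
  refine Submodule.mem_span_singleton.mpr ⟨c, ?_⟩
  ext i <;> simp [h1, h2]

theorem finrank_ker_cornerBoundary_le (hG : G.Connected) :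
    Module.finrank ℚ (LinearMap.ker M.cornerBoundary) ≤ 1 := by
  refine (Submodule.finrank_mono (t := Submodule.span ℚ {(1 : G.edgeSet → ℚ)})
    fun x hx => ?_).trans (by
      simpa using finrank_span_le_card (R := ℚ) {(1 : G.edgeSet → ℚ)})
  have hc := eq_of_invariant (M := M) hG.preconnected (x := fun d => x ⟨d.edge, d.edge_mem⟩)
    (fun d => by simp only [SimpleGraph.Dart.edge_symm]) (fun d => by
      have := congrFun (LinearMap.mem_ker.mp hx) (M.rot d)
      simp only [cornerBoundary, LinearMap.coe_mk, AddHom.coe_mk, Equiv.symm_apply_apply,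
        Pi.zero_apply] at this
      exact sub_eq_zero.mp this)
  rw [Submodule.mem_span_singleton]
  by_cases hne : Nonempty G.Dart
  · obtain ⟨d₀⟩ := hne
    refine ⟨x ⟨d₀.edge, d₀.edge_mem⟩, ?_⟩
    ext ⟨e, he⟩
    obtain ⟨⟨u, v⟩, rfl⟩ := Quot.exists_rep e
    exact (mul_one _).trans (hc d₀ ⟨(u, v), he⟩)
  · refine ⟨0, ?_⟩
    ext ⟨e, he⟩
    obtain ⟨⟨u, v⟩, rfl⟩ := Quot.exists_rep e
    exact absurd ⟨⟨(u, v), he⟩⟩ hne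

/-- The boundaries of the edges are cycles of the corner graph. -/
theorem cornerBoundary_dotProduct_cornerCoboundary [Fintype G.Dart] (x : G.edgeSet → ℚ)
    (y : (V → ℚ) × (M.Face → ℚ)) : M.cornerBoundary x ⬝ᵥ M.cornerCoboundary y = 0 := by
  simp only [cornerBoundary, cornerCoboundary, LinearMap.coe_mk, AddHom.coe_mk, dotProduct,
    mul_sub, Finset.sum_sub_distrib, sub_mul]
  -- The corner before `d` in the rotation has the same vertex as `d`, and its edge is that of the
  -- preceding dart on the face of `d`. Reindexing by `rot` cancels the vertex terms, by `facePerm`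
  -- the face terms.
  have h1 := Equiv.sum_comp M.rot fun d : G.Dart =>
    x ⟨(M.rot.symm d).edge, (M.rot.symm d).edge_mem⟩ * y.1 d.fst
  have h2 := Equiv.sum_comp M.facePerm fun d : G.Dart =>
    x ⟨(M.rot.symm d).edge, (M.rot.symm d).edge_mem⟩ * y.2 (M.faceOf d)
  simp only [Equiv.symm_apply_apply, fst_rot] at h1
  simp only [rot_symm_eq_symm_facePerm_symm, Equiv.symm_apply_apply, faceOf_facePerm,
    SimpleGraph.Dart.edge_symm] at h2
  simp only [rot_symm_eq_symm_facePerm_symm, SimpleGraph.Dart.edge_symm] at h1 ⊢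
  rw [h1, h2]
  ring

variable {M}

/-- On the sphere every cycle of the corner graph is a boundary. -/
theorem IsSpherical.exists_cornerBoundary_eq [Finite V] [Fintype G.Dart] (hM : M.IsSpherical)
    {z : G.Dart → ℚ} (hz : ∀ y, z ⬝ᵥ M.cornerCoboundary y = 0) :
    ∃ x, M.cornerBoundary x = z := by
  classical
  have := Fintype.ofFinite V
  have := Fintype.ofFinite M.Face
  obtain ⟨hG, hE⟩ := hM
  have h1 := M.finrank_ker_cornerCoboundary_le hG
  have h2 := M.finrank_ker_cornerBoundary_le hG
  have h3 := LinearMap.finrank_range_add_finrank_ker M.cornerCoboundary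
  have h4 := LinearMap.finrank_range_add_finrank_ker M.cornerBoundary
  have h5 := finrank_comap_dualAnnihilator (LinearMap.range M.cornerCoboundary)
  have h6 : Fintype.card G.Dart = 2 * Fintype.card G.edgeSet := by
    rw [← SimpleGraph.edgeFinset_card]
    convert SimpleGraph.dart_card_eq_twice_card_edges (G := G)
  rw [Module.finrank_prod, Module.finrank_fintype_fun_eq_card,
    Module.finrank_fintype_fun_eq_card] at h3
  rw [Module.finrank_fintype_fun_eq_card] at h4
  rw [Nat.card_eq_fintype_card, Nat.card_eq_fintype_card, Nat.card_eq_fintype_card] at hE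
  have hle : LinearMap.range M.cornerBoundary ≤
      (LinearMap.range M.cornerCoboundary).dualAnnihilator.comap
        (dotProductEquiv ℚ G.Dart).toLinearMap := by
    rintro _ ⟨x, rfl⟩
    rw [Submodule.mem_comap, Submodule.mem_dualAnnihilator]
    rintro _ ⟨y, rfl⟩
    exact M.cornerBoundary_dotProduct_cornerCoboundary x y
  -- The cycle space has dimension at most `2|E| - (|V| + |F| - 1) = |E| - 1`, and the boundaries
  -- have dimension at least `|E| - 1`.
  have heq := Submodule.eq_of_le_of_finrank_le hle (by omega)
  have hmem : z ∈ LinearMap.range M.cornerBoundary := by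
    rw [heq, Submodule.mem_comap, Submodule.mem_dualAnnihilator]
    rintro _ ⟨y, rfl⟩
    exact hz y
  exact hmem

/-! ### Regions of a subgraph and Euler's inequality -/

variable (M)

/-- Darts separated only by edges of the map and by corners outside `H`. The classes of the
equivalence relation this generates are the faces of the subgraph `H` of the corner graph. -/
def SameRegion (H : Finset G.Dart) (d e : G.Dart) : Prop :=
  e = d.symm ∨ e = M.rot d ∧ e ∉ H

/-- The boundary of a combination of faces of a subgraph of the corner graph. -/
def regionBoundary (H : Finset G.Dart) : (Quot (M.SameRegion H) → ℚ) →ₗ[ℚ] (G.Dart → ℚ) where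
  toFun x d := x (Quot.mk _ d) - x (Quot.mk _ (M.rot.symm d))
  map_add' y y' := by ext d; simp only [Pi.add_apply]; ring
  map_smul' c y := by
    ext d; simp only [Pi.smul_apply, smul_eq_mul, RingHom.id_apply]
    ring

variable {M}

theorem mk_symm_eq (H : Finset G.Dart) (d : G.Dart) :
    Quot.mk (M.SameRegion H) d.symm = Quot.mk _ d :=
  (Quot.sound (.inl rfl)).symm

theorem mk_rot_symm_eq {H : Finset G.Dart} {d : G.Dart} (hd : d ∉ H) :
    Quot.mk (M.SameRegion H) (M.rot.symm d) = Quot.mk _ d :=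
  Quot.sound (.inr ⟨(M.rot.apply_symm_apply d).symm, hd⟩)

theorem regionBoundary_apply_of_notMem {H : Finset G.Dart} (x : Quot (M.SameRegion H) → ℚ)
    {d : G.Dart} (hd : d ∉ H) : M.regionBoundary H x d = 0 := by
  simp [regionBoundary, mk_rot_symm_eq hd]

/-- The boundary of a combination of regions is a cycle of the corner graph. -/
theorem regionBoundary_dotProduct_cornerCoboundary [Fintype G.Dart] {H : Finset G.Dart}
    (x : Quot (M.SameRegion H) → ℚ) (y : (V → ℚ) × (M.Face → ℚ)) :
    M.regionBoundary H x ⬝ᵥ M.cornerCoboundary y = 0 := by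
  have hedge : ∀ d e : G.Dart, d.edge = e.edge →
      Quot.mk (M.SameRegion H) d = Quot.mk _ e := by
    intro d e hde
    rcases (SimpleGraph.dart_edge_eq_iff d e).mp hde with rfl | rfl
    · rfl
    · exact mk_symm_eq H e
  have hout : ∀ e : G.edgeSet, ∃ d : G.Dart, d.edge = e := by
    rintro ⟨e, he⟩
    obtain ⟨⟨u, v⟩, rfl⟩ := Quot.exists_rep e
    exact ⟨⟨(u, v), he⟩, rfl⟩
  -- A function on regions is invariant under reversal, so it descends to edges and its boundary is
  -- a `cornerBoundary`.
  choose r hr using hout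
  convert M.cornerBoundary_dotProduct_cornerCoboundary (fun e => x (Quot.mk _ (r e))) y using 2
  ext d
  simp only [regionBoundary, cornerBoundary, LinearMap.coe_mk, AddHom.coe_mk]
  rw [hedge (r ⟨d.edge, d.edge_mem⟩) d (hr _),
    hedge (r ⟨(M.rot.symm d).edge, (M.rot.symm d).edge_mem⟩) (M.rot.symm d) (hr _)]

/-- Euler's inequality for a subgraph of the corner graph of a spherical map. -/
theorem IsSpherical.card_add_two_le [Finite V] (hM : M.IsSpherical) {A : Finset V}
    {B : Finset M.Face} (hA : A.Nonempty) {H : Finset G.Dart} (hH : H.Nonempty)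
    (hHA : ∀ d ∈ H, d.fst ∈ A) (hHB : ∀ d ∈ H, M.faceOf d ∈ B) :
    H.card + 2 ≤ A.card + B.card + Nat.card (Quot (M.SameRegion H)) := by
  classical
  have := Fintype.ofFinite G.Dart
  have := Fintype.ofFinite (Quot (M.SameRegion H))
  let δ : ((A → ℚ) × (B → ℚ)) →ₗ[ℚ] (H → ℚ) :=
    { toFun := fun y d => y.1 ⟨d.1.fst, hHA d d.2⟩ - y.2 ⟨M.faceOf d.1, hHB d d.2⟩
      map_add' := fun y y' => by
        ext d; simp only [Prod.fst_add, Prod.snd_add, Pi.add_apply]; ring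
      map_smul' := fun c y => by
        ext d
        simp only [Prod.smul_fst, Prod.smul_snd, Pi.smul_apply, smul_eq_mul, RingHom.id_apply]
        ring }
  let ρ : (G.Dart → ℚ) →ₗ[ℚ] (H → ℚ) := LinearMap.funLeft ℚ ℚ Subtype.val
  -- Constants lie in the kernels of both maps; each kernel contributes 1 to the 2 in the
  -- inequality.
  have hδ : 1 ≤ Module.finrank ℚ (LinearMap.ker δ) := by
    refine Submodule.one_le_finrank_iff.mpr ((Submodule.ne_bot_iff _).mpr ⟨(1, 1), ?_, fun h => ?_⟩)
    · ext d; simp [δ]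
    · obtain ⟨a, ha⟩ := hA
      simpa using congrFun (congrArg Prod.fst h) ⟨a, ha⟩
  have hβ : 1 ≤ Module.finrank ℚ (LinearMap.ker (ρ ∘ₗ M.regionBoundary H)) := by
    refine Submodule.one_le_finrank_iff.mpr ((Submodule.ne_bot_iff _).mpr ⟨1, ?_, fun h => ?_⟩)
    · ext d; simp [ρ, regionBoundary]
    · obtain ⟨a, ha⟩ := hH
      simpa using congrFun h (Quot.mk _ a)
  have h1 := LinearMap.finrank_range_add_finrank_ker δ
  have h2 := LinearMap.finrank_range_add_finrank_ker (ρ ∘ₗ M.regionBoundary H)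
  have h3 := finrank_comap_dualAnnihilator (LinearMap.range δ)
  rw [Module.finrank_prod, Module.finrank_fintype_fun_eq_card,
    Module.finrank_fintype_fun_eq_card, Fintype.card_coe, Fintype.card_coe] at h1
  rw [Module.finrank_fintype_fun_eq_card] at h2
  rw [Fintype.card_coe] at h3
  -- A cycle in `H`, extended by zero, bounds an edge potential on the sphere. Since the cycle
  -- vanishes off `H`, this potential is constant on regions.
  have hle : (LinearMap.range δ).dualAnnihilator.comap (dotProductEquiv ℚ H).toLinearMap ≤
      LinearMap.range (ρ ∘ₗ M.regionBoundary H) := by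
    intro z hz
    rw [Submodule.mem_comap, Submodule.mem_dualAnnihilator] at hz
    have hz' : ∀ y, z ⬝ᵥ δ y = 0 := fun y => hz _ ⟨y, rfl⟩
    obtain ⟨x, hx⟩ := hM.exists_cornerBoundary_eq
      (z := fun d => if h : d ∈ H then z ⟨d, h⟩ else 0) (fun y => by
        refine Eq.trans ?_ (hz' (fun a => y.1 a, fun b => y.2 b))
        rw [dotProduct, dotProduct,
          ← Finset.sum_subset (Finset.subset_univ H) (fun d _ hd => by simp [hd]),
          ← Finset.sum_coe_sort H]
        exact Finset.sum_congr rfl fun d _ => by simp [cornerCoboundary, δ])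
    have hx' := fun d => congrFun hx d
    simp only [cornerBoundary, LinearMap.coe_mk, AddHom.coe_mk] at hx'
    refine ⟨Quot.lift (fun d => x ⟨d.edge, d.edge_mem⟩) ?_, ?_⟩
    · rintro d e (rfl | ⟨rfl, hd⟩)
      · simp only [SimpleGraph.Dart.edge_symm]
      · have := hx' (M.rot d)
        simp only [Equiv.symm_apply_apply, hd, dite_false] at this
        linarith
    · ext d
      have := hx' d
      simpa [ρ, regionBoundary, LinearMap.funLeft] using this
  have h4 := Submodule.finrank_mono hle
  rw [Nat.card_eq_fintype_card]
  omega

/-! ### Counting incidences -/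

/-- A nonzero cycle of the corner graph that runs through every corner at most once has length at
least four. -/
theorem four_le_card_support [Fintype G.Dart] {H : Finset G.Dart}
    (hinj : Set.InjOn (fun d : G.Dart => (d.fst, M.faceOf d)) H) {z : G.Dart → ℚ}
    (hzH : ∀ d ∉ H, z d = 0) (hz : ∀ y, z ⬝ᵥ M.cornerCoboundary y = 0) {d : G.Dart}
    (hd : z d ≠ 0) : 4 ≤ (H.filter (z · ≠ 0)).card := by
  classical
  have hmem : ∀ d, z d ≠ 0 → d ∈ H := fun d => not_imp_comm.mp (hzH d)
  have hne : ∀ d e, z d ≠ 0 → z e ≠ 0 → d ≠ e → d.fst = e.fst → M.faceOf d ≠ M.faceOf e :=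
    fun d e hd he hde h1 h2 => hde (hinj (hmem d hd) (hmem e he) (Prod.ext h1 h2))
  -- Testing the cycle against the indicator of a node shows that its values at that node sum to
  -- zero, so no node meets its support exactly once.
  have hvert : ∀ d, z d ≠ 0 → ∃ e, z e ≠ 0 ∧ e ≠ d ∧ e.fst = d.fst := by
    intro d hd
    have hsum : ∑ e with e.fst = d.fst, z e = 0 := by
      rw [← hz (Pi.single d.fst 1, 0), Finset.sum_filter]
      exact Finset.sum_congr rfl fun e _ => by simp [cornerCoboundary, Pi.single_apply]
    obtain ⟨e, he, hed, hze⟩ :=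
      Finset.exists_ne_of_sum_eq_zero_of_ne_zero hsum
        (Finset.mem_filter.mpr ⟨Finset.mem_univ d, rfl⟩) hd
    exact ⟨e, hze, hed, (Finset.mem_filter.mp he).2⟩
  have hface : ∀ d, z d ≠ 0 → ∃ e, z e ≠ 0 ∧ e ≠ d ∧ M.faceOf e = M.faceOf d := by
    intro d hd
    have hsum : ∑ e with M.faceOf e = M.faceOf d, z e = 0 := by
      rw [← neg_eq_zero, ← hz (0, Pi.single (M.faceOf d) 1), Finset.sum_filter,
        ← Finset.sum_neg_distrib]
      exact Finset.sum_congr rfl fun e _ => by simp [cornerCoboundary, Pi.single_apply]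
    obtain ⟨e, he, hed, hze⟩ :=
      Finset.exists_ne_of_sum_eq_zero_of_ne_zero hsum
        (Finset.mem_filter.mpr ⟨Finset.mem_univ d, rfl⟩) hd
    exact ⟨e, hze, hed, (Finset.mem_filter.mp he).2⟩
  -- Two corners at one vertex lie on different faces, and each of these faces carries a further
  -- corner, so the four are distinct.
  obtain ⟨e, he, hed, hedv⟩ := hvert d hd
  obtain ⟨d', hd', hdd, hddf⟩ := hface d hd
  obtain ⟨e', he', hee, heef⟩ := hface e he
  have hfe : M.faceOf e ≠ M.faceOf d := hne e d he hd hed hedv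
  have hcard : ({d, e, d', e'} : Finset G.Dart).card = 4 := by
    have h1 : d ≠ d' := hdd.symm
    have h2 : d ≠ e' := fun h => hfe (heef.symm.trans (congrArg M.faceOf h).symm)
    have h3 : e ≠ d' := fun h => hfe ((congrArg M.faceOf h).trans hddf)
    have h4 : d' ≠ e' := fun h => hfe (hddf.symm.trans ((congrArg M.faceOf h).trans heef)).symm
    rw [Finset.card_insert_of_notMem, Finset.card_insert_of_notMem, Finset.card_pair h4] <;>
      simp [hed.symm, h1, h2, h3, hee.symm]
  rw [← hcard]
  refine Finset.card_le_card fun a ha => Finset.mem_filter.mpr ?_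
  simp only [Finset.mem_insert, Finset.mem_singleton] at ha
  rcases ha with rfl | rfl | rfl | rfl
  exacts [⟨hmem _ hd, hd⟩, ⟨hmem _ he, he⟩, ⟨hmem _ hd', hd'⟩, ⟨hmem _ he', he'⟩]

/-- If a subgraph of the corner graph has several faces, then it has at least twice as many edges
as faces. -/
theorem two_mul_card_region_le [Finite V] (hG : G.Preconnected) {H : Finset G.Dart}
    (hinj : Set.InjOn (fun d : G.Dart => (d.fst, M.faceOf d)) H)
    (hcard : 1 < Nat.card (Quot (M.SameRegion H))) :
    2 * Nat.card (Quot (M.SameRegion H)) ≤ H.card := by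
  classical
  have := Fintype.ofFinite G.Dart
  have := Fintype.ofFinite (Quot (M.SameRegion H))
  rw [Nat.card_eq_fintype_card] at hcard ⊢
  have hlow : ∀ c : Quot (M.SameRegion H),
      4 ≤ (H.filter (M.regionBoundary H (Pi.single c 1) · ≠ 0)).card := by
    intro c
    -- If the boundary of one region vanished, its indicator would be constant on the connected map,
    -- which is impossible with a second region.
    obtain ⟨d, hd⟩ : ∃ d, M.regionBoundary H (Pi.single c 1) d ≠ 0 := by
      by_contra! hzero
      obtain ⟨c', hc'⟩ := Fintype.exists_ne_of_one_lt_card hcard c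
      obtain ⟨d, rfl⟩ := Quot.exists_rep c
      obtain ⟨e, rfl⟩ := Quot.exists_rep c'
      have := eq_of_invariant (M := M) hG
        (x := fun a => (Pi.single (Quot.mk (M.SameRegion H) d) 1 : _ → ℚ) (Quot.mk _ a))
        (fun a => by rw [mk_symm_eq]) (fun a => by
          have := hzero (M.rot a)
          simp only [regionBoundary, LinearMap.coe_mk, AddHom.coe_mk,
            Equiv.symm_apply_apply] at this
          exact sub_eq_zero.mp this) d e
      simp [hc'] at this
    exact four_le_card_support hinj (fun d => regionBoundary_apply_of_notMem _)
      (regionBoundary_dotProduct_cornerCoboundary _) hd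
  have hup : ∀ d ∈ H, (Finset.univ.filter fun c : Quot (M.SameRegion H) =>
      M.regionBoundary H (Pi.single c 1) d ≠ 0).card ≤ 2 := by
    intro d _
    refine (Finset.card_le_card (t := {Quot.mk _ d, Quot.mk _ (M.rot.symm d)})
      fun c hc => ?_).trans Finset.card_le_two
    by_contra hne
    simp only [Finset.mem_insert, Finset.mem_singleton, not_or] at hne
    refine (Finset.mem_filter.mp hc).2 ?_
    simp [regionBoundary, Ne.symm hne.1, Ne.symm hne.2]
  -- Each region has at least four boundary corners, and each corner borders at most two regions.
  have hdouble := Finset.sum_card_bipartiteAbove_eq_sum_card_bipartiteBelow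
    (s := (Finset.univ : Finset (Quot (M.SameRegion H)))) (t := H)
    (fun c d => M.regionBoundary H (Pi.single c 1) d ≠ 0)
  have h1 := Finset.card_nsmul_le_sum (Finset.univ : Finset (Quot (M.SameRegion H))) _ 4
    fun c _ => hlow c
  have h2 := Finset.sum_le_card_nsmul H _ 2 hup
  simp only [Finset.bipartiteAbove, Finset.bipartiteBelow] at hdouble
  rw [hdouble, Finset.card_univ, smul_eq_mul] at h1
  rw [smul_eq_mul] at h2
  omega

/-- In a spherical map there are fewer than `2 (|A| + |B|)` incidences between a nonempty set `A`
of vertices and a set `B` of faces. -/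
theorem IsSpherical.card_incidences_lt [Finite V] (hM : M.IsSpherical) {A : Finset V}
    (hA : A.Nonempty) (B : Finset M.Face) :
    {p : V × M.Face | p.1 ∈ A ∧ p.2 ∈ B ∧ p.1 ∈ M.verts p.2}.ncard < 2 * (A.card + B.card) := by
  classical
  have := Fintype.ofFinite (V × M.Face)
  set I : Finset (V × M.Face) := Finset.univ.filter fun p => p.1 ∈ A ∧ p.2 ∈ B ∧ p.1 ∈ M.verts p.2
  have hI : {p : V × M.Face | p.1 ∈ A ∧ p.2 ∈ B ∧ p.1 ∈ M.verts p.2} = I := by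
    ext p; simp [I]
  rw [hI, Set.ncard_coe_finset]
  have hmem : ∀ p ∈ I, p.1 ∈ A ∧ p.2 ∈ B ∧ p.1 ∈ M.verts p.2 :=
    fun p hp => (Finset.mem_filter.mp hp).2
  have hdart : ∀ p : I, ∃ d : G.Dart, (d.fst, M.faceOf d) = p.1 := by
    rintro ⟨p, hp⟩
    obtain ⟨-, -, d, hd, hv⟩ := hmem p hp
    exact ⟨d, Prod.ext hv hd⟩
  -- A vertex may occur several times on a face; one dart per incidence keeps the subgraph simple.
  choose r hr using hdart
  have hrinj : Function.Injective r := fun p q hpq =>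
    Subtype.ext (by rw [← hr p, hpq, hr q])
  set H : Finset G.Dart := Finset.univ.map ⟨r, hrinj⟩
  have hHI : H.card = I.card := by simp [H]
  have hHp : ∀ d ∈ H, ∃ p : I, r p = d := by simp [H]
  rcases H.eq_empty_or_nonempty with h0 | hH
  · have := hA.card_pos
    rw [← hHI, h0, Finset.card_empty]
    omega
  have hEuler := hM.card_add_two_le (B := B) hA hH
    (fun d hd => by
      obtain ⟨p, rfl⟩ := hHp d hd
      rw [show (r p).fst = p.1.1 from congrArg Prod.fst (hr p)]
      exact (hmem p.1 p.2).1)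
    (fun d hd => by
      obtain ⟨p, rfl⟩ := hHp d hd
      rw [show M.faceOf (r p) = p.1.2 from congrArg Prod.snd (hr p)]
      exact (hmem p.1 p.2).2.1)
  have hinj : Set.InjOn (fun d : G.Dart => (d.fst, M.faceOf d)) H := by
    intro d hd e he hde
    obtain ⟨p, rfl⟩ := hHp d hd
    obtain ⟨q, rfl⟩ := hHp e he
    exact congrArg r (Subtype.ext ((hr p).symm.trans (hde.trans (hr q))))
  -- With several regions their number is at most `|H| / 2`, giving `|H| + 4 ≤ 2(|A| + |B|)`; with
  -- one, Euler's inequality gives `|H| < |A| + |B|` directly.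
  by_cases hc : 1 < Nat.card (Quot (M.SameRegion H))
  · have := two_mul_card_region_le hM.1.preconnected hinj hc
    omega
  · omega

/-! ### Coloring and the metric mapping -/

/-- The graph joining each vertex to the vertices of its dual face. -/
def IsStronglyInvolutive.incidenceGraph {τ : G ≃g M.dualGraph} (hτ : M.IsStronglyInvolutive τ) :
    SimpleGraph V where
  Adj u v := u ∈ M.verts (τ v)
  symm := ⟨fun u v h => (hτ.mem_comm u v).mp h⟩
  loopless := ⟨hτ.notMem_self⟩

/-- If all degrees within `W` were at least 4, there would be at least `4|W|` incidences between `W`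
and its image under the injective `τ`, against the planar bound. -/
theorem IsStronglyInvolutive.colorable_incidenceGraph [Finite V] {τ : G ≃g M.dualGraph}
    (hτ : M.IsStronglyInvolutive τ) (hM : M.IsSpherical) : hτ.incidenceGraph.Colorable 4 := by
  classical
  have := Fintype.ofFinite V
  refine SimpleGraph.colorable_four_of_degenerate _ fun W hW => ?_
  by_contra! hdeg
  have hlt := hM.card_incidences_lt hW (W.map τ.toEquiv.toEmbedding)
  rw [Finset.card_map] at hlt
  have heq : {p : V × M.Face | p.1 ∈ W ∧ p.2 ∈ W.map τ.toEquiv.toEmbedding ∧ p.1 ∈ M.verts p.2} =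
      ((W.sigma fun v => W.filter fun u => hτ.incidenceGraph.Adj u v).map
        ⟨fun q : (_ : V) × V => (q.2, τ q.1), by
          rintro ⟨a, b⟩ ⟨a', b'⟩ h
          simpa [and_comm] using h⟩ : Finset (V × M.Face)) := by
    ext ⟨u, f⟩
    simp only [Set.mem_ofPred_eq, Finset.coe_map, Set.mem_image, Finset.mem_coe, Finset.mem_sigma,
      Finset.mem_filter, Finset.mem_map]
    constructor
    · rintro ⟨hu, ⟨v, hv, rfl⟩, h⟩
      exact ⟨⟨v, u⟩, ⟨hv, hu, h⟩, rfl⟩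
    · rintro ⟨⟨v, u'⟩, ⟨hv, hu, h⟩, h'⟩
      obtain ⟨rfl, rfl⟩ := Prod.mk.inj h'
      exact ⟨hu, ⟨v, hv, rfl⟩, h⟩
  rw [heq, Set.ncard_coe_finset, Finset.card_map, Finset.card_sigma] at hlt
  have hsum := Finset.card_nsmul_le_sum W
    (fun v => (W.filter fun u => hτ.incidenceGraph.Adj u v).card) 4 fun v hv => by
      convert hdeg v hv
      rw [← Set.ncard_coe_finset]
      simp
  rw [smul_eq_mul] at hsum
  omega

end RotationSystem

theorem theorem1 {V : Type*} [Finite V] (G : SimpleGraph V) (hG : G.IsKConnected 3)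
    (M : RotationSystem G) (hM : M.IsSpherical)
    (τ : G ≃g M.dualGraph) (hτ : M.IsStronglyInvolutive τ) :
    ∃ η : V → EuclideanSpace ℝ (Fin 3), M.IsMetricMapping τ η := by
  obtain ⟨c⟩ := hτ.colorable_incidenceGraph hM
  obtain ⟨p, hp⟩ := exists_regular_tetrahedron
  have hdist : ∀ u v : V, u ∈ M.verts (τ v) → dist (p (c u)) (p (c v)) = 1 :=
    fun u v huv => hp _ _ (c.valid (show hτ.incidenceGraph.Adj u v from huv))
  refine ⟨fun v => p (c v), le_antisymm ?_ ?_, hdist⟩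
  · refine Metric.diam_le_of_forall_dist_le zero_le_one ?_
    rintro _ ⟨u, rfl⟩ _ ⟨v, rfl⟩
    by_cases huv : c u = c v
    · simp [huv]
    · exact (hp _ _ huv).le
  -- Distance 1 is attained: a face is a class of darts, so `τ v` has a vertex on its boundary.
  · have := hM.1.nonempty
    obtain ⟨v⟩ := this
    obtain ⟨d, hd⟩ := Quotient.exists_rep (τ v)
    rw [← hdist d.fst v ⟨d, hd, rfl⟩]
    exact Metric.dist_le_diam_of_mem (Set.finite_range _).isBounded ⟨_, rfl⟩ ⟨_, rfl⟩
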